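/- Let $d\in\mathbb{N}$ and let $\mathbb{F}$ be a nonempty set of Borel measurable functions $h:\mathbb{R}^d\to\mathbb{R}$. For a collection $\mathcal{B}$ of subsets of a set $X$, let the index $V(\mathcal{B})$ be the smallest $n\in\mathbb{N}$ such that for all $z_1,\dots,z_n\in X$ the collection $\{B\cap\{z_1,\dots,z_n\}\mid B\in\mathcal{B}\}$ has fewer than $2^n$ elements ($V(\mathcal{B}):=\infty$ if there is no such $n$). Let $V(\mathbb{F})$ be the index of the collection of subgraphs $\{(z,t)\in\mathbb{R}^d\times\mathbb{R}\mid h(z)>t\}$, $h\in\mathbb{F}$, and suppose that $\mathbb{F}$ is a VC-subgraph class, i.e. $V(\mathbb{F})<\infty$. Let $C_{\mathbb{F}}:\mathbb{R}^d\to\mathbb{R}$ be a positive envelope of $\mathbb{F}$, i.e. a Borel measurable function with strictly positive values such that $|h(z)|\le C_{\mathbb{F}}(z)$ for all $h\in\mathbb{F}$ and $z\in\mathbb{R}^d$. Let $\mathcal{M}_{\mathrm{fin}}$ be the set of all Borel probability measures on $\mathbb{R}^d$ with finite support. For $\mathbb{Q}\in\mathcal{M}_{\mathrm{fin}}$ let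 $\|\cdot\|_{\mathbb{Q},2}$ be the $L^2(\mathbb{Q})$-norm, and for $\eta>0$ let $N(\eta,\mathbb{F},L^2(\mathbb{Q}))$ be the minimal number of closed $L^2(\mathbb{Q})$-balls of radius $\eta$ with centers in $\mathbb{F}$ that cover $\mathbb{F}$ ($\infty$ if there is no finite cover). Then, for every $\varepsilon\in(0,1)$, $$ \sup_{\mathbb{Q}\in\mathcal{M}_{\mathrm{fin}}}N\big(\varepsilon\|C_{\mathbb{F}}\|_{\mathbb{Q},2},\mathbb{F},L^2(\mathbb{Q})\big)\le e\,V(\mathbb{F})\,\Big(\frac{4e^{1/2}}{\varepsilon}\Big)^{2(V(\mathbb{F})-1)}. $$ -/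

import Mathlib

open MeasureTheory
open scoped ENNReal

noncomputable section

namespace EmpiricalProcess

/-- The number of traces: the cardinality of
`{B ∩ {z₁, …, zₙ} | B ∈ 𝓑}` for a collection `𝓑` of subsets of `X`. -/
def traceCard {X : Type*} (𝓑 : Set (Set X)) {n : ℕ} (z : Fin n → X) : ℕ∞ :=
  Set.encard {S : Set X | ∃ B ∈ 𝓑, S = B ∩ Set.range z}

/-- The index of `𝓑`: the smallest `n` such that every choice of `n` points has fewer than `2 ^ n`
traces, and `⊤` if there is no such `n`. -/
def vcIndex {X : Type*} (𝓑 : Set (Set X)) : ℕ∞ :=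
  ⨅ (n : ℕ) (_ : ∀ z : Fin n → X, traceCard 𝓑 z < 2 ^ n), (n : ℕ∞)

/-- A VC-class of sets: a collection of finite index. -/
def IsVCClass {X : Type*} (𝓑 : Set (Set X)) : Prop :=
  vcIndex 𝓑 ≠ ⊤

/-- The subgraphs `{(z, t) | h z > t}`, for `h ∈ F`. -/
def subgraphs {E : Type*} (F : Set (E → ℝ)) : Set (Set (E × ℝ)) :=
  {B | ∃ h ∈ F, B = {p : E × ℝ | p.2 < h p.1}}

/-- The VC-index of a class of functions is the index of the collection of its subgraphs. -/
def vcSubgraphIndex {E : Type*} (F : Set (E → ℝ)) : ℕ∞ :=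
  vcIndex (subgraphs F)

/-- A VC-subgraph class: a set of measurable real functions whose subgraphs form a VC-class. -/
def IsVCSubgraphClass {E : Type*} [MeasurableSpace E] (F : Set (E → ℝ)) : Prop :=
  (∀ h ∈ F, Measurable h) ∧ IsVCClass (subgraphs F)

/-- A positive envelope: a measurable function with strictly positive values that dominates `|h|`
pointwise for every `h ∈ F`. -/
def IsPositiveEnvelope {E : Type*} [MeasurableSpace E] (F : Set (E → ℝ)) (C : E → ℝ) : Prop :=
  Measurable C ∧ (∀ h ∈ F, ∀ z, |h z| ≤ C z) ∧ ∀ z, 0 < C z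

/-- The probability measures with finite support. -/
def finSuppProb (E : Type*) [MeasurableSpace E] : Set (Measure E) :=
  {Q | IsProbabilityMeasure Q ∧ ∃ s : Finset E, Q (s : Set E)ᶜ = 0}

/-- The covering number `N(η, F, L^p(Q))`: the minimal number of closed `L^p(Q)`-balls of
radius `η` with centers in `F` that cover `F`. It is `⊤` if there is no finite cover. -/
def lpCoveringNumber {E : Type*} [MeasurableSpace E] (η : ℝ≥0∞) (F : Set (E → ℝ)) (p : ℝ≥0∞)
    (Q : Measure E) : ℕ∞ :=
  ⨅ (T : Set (E → ℝ)) (_ : T ⊆ F) (_ : ∀ f ∈ F, ∃ g ∈ T, eLpNorm (f - g) p Q ≤ η), T.encard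

end EmpiricalProcess

end

/-! A maximal separated subset of `F` is a net, so it suffices to bound the size of a finite `T ⊆ F`
that is `ε‖C‖`-separated in `L²(Q)`. Put mass `Q{z} C(z) dt` on `|t| ≤ C(z)` and normalise. Since
`|f - g| ≤ 2C`, subgraphs of distinct members of `T` then differ by mass at least `ε²/4`, and
Haussler's packing bound `card_le_of_separated` with `d = V - 1`, `δ = ε²/4` gives the constant.

For Haussler's bound, draw `n + 1` i.i.d. points and form the one-inclusion graph of the traces,
each vertex weighted by the number of sets with that trace. By `sum_edges_min_le` the total edge
weight is at most `d` times the number `N` of sets. Conversely, reveal all points but one: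
separation makes the last point split each class of sets with equal trace, so each direction has
expected weight at least `δ/2 * (N - S)`, where `S` is the Sauer–Shelah bound on traces. Comparing
the two for `n ≈ 2(d + 1)/δ` gives `N ≤ (d + 1) S`. -/

namespace EmpiricalProcess

/-! ### One-inclusion graphs and binomial sums -/

/-- Weighted edge bound for one-inclusion graphs: if the support of `w` shatters no set of more than
`d` elements, then the edges of the cube, weighted by the smaller weight of their two ends, have
total weight at most `d` times the total weight of the vertices. -/
theorem sum_edges_min_le {α : Type*} [DecidableEq α] (u : Finset α) :
    ∀ (d : ℕ) (w : Finset α → ℕ),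
      (∀ S ⊆ u, (∀ T ⊆ S, ∃ A ⊆ u, w A ≠ 0 ∧ S ∩ A = T) → S.card ≤ d) →
      ∑ i ∈ u, ∑ A ∈ (u.erase i).powerset, min (w A) (w (insert i A)) ≤
        d * ∑ A ∈ u.powerset, w A := by
  induction u using Finset.induction_on with
  | empty => intro d w _; simp
  | insert x u hx ih =>
    intro d w hw
    -- Collapse the cube along `x`. The support of `M` is a projection and shatters at most `d`
    -- elements; that of `I` shatters at most `d - 1`, since `x` can be added to any set it
    -- shatters. Edges in direction `x` weigh `∑ I`, so the total is at most `d ∑ M + (d - 1) ∑ I +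
    -- ∑ I`.
    set M : Finset α → ℕ := fun A => max (w A) (w (insert x A)) with hM
    set I : Finset α → ℕ := fun A => min (w A) (w (insert x A)) with hI
    have hxS : ∀ {S : Finset α}, S ⊆ u → x ∉ S := fun hS h => hx (hS h)
    have hMu : ∑ i ∈ u, ∑ A ∈ (u.erase i).powerset, min (M A) (M (insert i A)) ≤
        d * ∑ A ∈ u.powerset, M A := by
      refine ih d M fun S hS h => hw S (hS.trans (Finset.subset_insert _ _)) fun T hT => ?_
      obtain ⟨A, hA, hwA, rfl⟩ := h T hT
      by_cases h0 : w A = 0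
      · refine ⟨insert x A, Finset.insert_subset_insert _ hA, fun h1 => hwA (by simp [hM, h0, h1]),
          ?_⟩
        rw [Finset.inter_insert_of_notMem (hxS hS)]
      · exact ⟨A, hA.trans (Finset.subset_insert _ _), h0, rfl⟩
    have hsh : ∀ S ⊆ u, (∀ T ⊆ S, ∃ A ⊆ u, I A ≠ 0 ∧ S ∩ A = T) → S.card + 1 ≤ d := by
      intro S hS h
      rw [← Finset.card_insert_of_notMem (hxS hS)]
      refine hw _ (Finset.insert_subset_insert _ hS) fun T hT => ?_
      obtain ⟨A, hA, hwA, hSA⟩ := h (T.erase x) (by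
        rw [← Finset.subset_insert_iff]; exact hT)
      have h0 : w A ≠ 0 := fun h => hwA (by simp [hI, h])
      have h1 : w (insert x A) ≠ 0 := fun h => hwA (by simp [hI, h])
      by_cases hxT : x ∈ T
      · refine ⟨insert x A, Finset.insert_subset_insert _ hA, h1, ?_⟩
        rw [← Finset.insert_inter_distrib, hSA, Finset.insert_erase hxT]
      · refine ⟨A, hA.trans (Finset.subset_insert _ _), h0, ?_⟩
        rw [Finset.insert_inter_of_notMem (hxS hA), hSA, Finset.erase_eq_of_notMem hxT]
    have hIu : ∑ i ∈ u, ∑ A ∈ (u.erase i).powerset, min (I A) (I (insert i A)) +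
        ∑ A ∈ u.powerset, I A ≤ d * ∑ A ∈ u.powerset, I A := by
      rcases Nat.eq_zero_or_pos d with rfl | hd
      · have hz : ∀ A ⊆ u, I A = 0 := by
          intro A hA
          by_contra h
          have := hsh ∅ (Finset.empty_subset _) fun T hT =>
            ⟨A, hA, h, by rw [Finset.subset_empty.1 hT, Finset.empty_inter]⟩
          omega
        have h1 : ∑ A ∈ u.powerset, I A = 0 :=
          Finset.sum_eq_zero fun A hA => hz A (Finset.mem_powerset.1 hA)
        have h2 : ∑ i ∈ u, ∑ A ∈ (u.erase i).powerset, min (I A) (I (insert i A)) = 0 := by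
          refine Finset.sum_eq_zero fun i _ => Finset.sum_eq_zero fun A hA => ?_
          rw [hz A ((Finset.mem_powerset.1 hA).trans (Finset.erase_subset _ _)), Nat.zero_min]
        rw [h1, h2]
      · have := ih (d - 1) I fun S hS h => by have := hsh S hS h; omega
        obtain ⟨k, rfl⟩ : ∃ k, d = k + 1 := ⟨d - 1, by omega⟩
        simp only [Nat.add_sub_cancel] at this
        rw [add_mul, one_mul]
        exact Nat.add_le_add_right this _
    have hdir : ∀ i ∈ u, ∑ A ∈ ((insert x u).erase i).powerset, min (w A) (w (insert i A)) ≤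
        ∑ A ∈ (u.erase i).powerset, min (M A) (M (insert i A)) +
          ∑ A ∈ (u.erase i).powerset, min (I A) (I (insert i A)) := by
      intro i hi
      have hxi : x ≠ i := fun h => hx (h ▸ hi)
      rw [Finset.erase_insert_of_ne hxi, Finset.sum_powerset_insert
        (fun h => hx (Finset.mem_of_mem_erase h)), ← Finset.sum_add_distrib,
        ← Finset.sum_add_distrib]
      -- The smaller of the two minima on the left is the least of all four weights; the other is at
      -- most both maxima.
      refine Finset.sum_le_sum fun A _ => ?_
      rw [Finset.insert_comm i x A]
      simp only [hM, hI]
      omega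
    have htot : ∑ A ∈ (insert x u).powerset, w A =
        ∑ A ∈ u.powerset, M A + ∑ A ∈ u.powerset, I A := by
      rw [Finset.sum_powerset_insert hx, ← Finset.sum_add_distrib, ← Finset.sum_add_distrib]
      exact Finset.sum_congr rfl fun A _ => (max_add_min _ _).symm
    rw [Finset.sum_insert hx, Finset.erase_insert hx, htot, mul_add]
    have h3 := Finset.sum_le_sum hdir
    rw [Finset.sum_add_distrib] at h3
    have h4 : ∑ A ∈ u.powerset, min (w A) (w (insert x A)) = ∑ A ∈ u.powerset, I A := rfl
    omega

/-- The partial sums of binomial coefficients are at most `(e n / d) ^ d`. -/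
theorem sum_choose_le_exp_mul_div_pow {n d : ℕ} (hd : 0 < d) (hdn : d ≤ n) :
    ((∑ k ∈ Finset.Iic d, n.choose k : ℕ) : ℝ) ≤ (Real.exp 1 * n / d) ^ d := by
  have hd' : (0 : ℝ) < d := by exact_mod_cast hd
  have hn' : (0 : ℝ) < n := by exact_mod_cast hd.trans_le hdn
  -- As `r ≤ 1`, `r ^ d ≤ r ^ k` for `k ≤ d`, so the sum times `r ^ d` is dominated by the binomial
  -- expansion of `(1 + r) ^ n ≤ e ^ d`.
  set r : ℝ := d / n with hr
  have hr0 : 0 < r := by positivity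
  have hr1 : r ≤ 1 := by rw [hr, div_le_one hn']; exact_mod_cast hdn
  have h1 : ((∑ k ∈ Finset.Iic d, n.choose k : ℕ) : ℝ) * r ^ d ≤ (1 + r) ^ n := by
    rw [add_comm, add_pow]
    push_cast
    rw [Finset.sum_mul]
    calc ∑ k ∈ Finset.Iic d, (n.choose k : ℝ) * r ^ d
        ≤ ∑ k ∈ Finset.Iic d, r ^ k * 1 ^ (n - k) * (n.choose k : ℝ) := by
          refine Finset.sum_le_sum fun k hk => ?_
          rw [one_pow, mul_one, mul_comm]
          exact mul_le_mul_of_nonneg_right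
            (pow_le_pow_of_le_one hr0.le hr1 (Finset.mem_Iic.1 hk)) (by positivity)
      _ ≤ _ := by
          refine Finset.sum_le_sum_of_subset_of_nonneg (fun k hk => ?_) fun _ _ _ => by positivity
          have := Finset.mem_Iic.1 hk
          exact Finset.mem_range.2 (by omega)
  have h2 : (1 + r) ^ n ≤ Real.exp 1 ^ d := by
    calc (1 + r) ^ n ≤ Real.exp r ^ n := by
          gcongr; rw [add_comm]; exact Real.add_one_le_exp r
      _ = Real.exp 1 ^ d := by
          rw [← Real.exp_nat_mul, ← Real.exp_nat_mul, hr]; congr 1; field_simp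
  have h3 : (Real.exp 1 * n / d) ^ d = Real.exp 1 ^ d / r ^ d := by
    rw [← div_pow, hr]; congr 1; field_simp
  rw [h3, le_div_iff₀ (by positivity)]
  exact h1.trans h2

/-! ### Haussler's packing theorem -/

section Haussler

open Classical in
/-- The coordinates of the sample `x` that lie in `S`. -/
noncomputable def sampleTrace {Ω : Type*} {n : ℕ} (x : Fin n → Ω) (S : Set Ω) : Finset (Fin n) :=
  Finset.univ.filter fun j => x j ∈ S

theorem mem_sampleTrace {Ω : Type*} {n : ℕ} {x : Fin n → Ω} {S : Set Ω} {j : Fin n} :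
    j ∈ sampleTrace x S ↔ x j ∈ S := by
  simp [sampleTrace]

variable {ι Ω : Type*}

/-- The family `B` shatters no `m` points. -/
def NotShatters (B : ι → Set Ω) (m : ℕ) : Prop :=
  ∀ z : Fin m → Ω, ∃ T : Finset (Fin m), ∀ f, sampleTrace z (B f) ≠ T

theorem NotShatters.card_le {B : ι → Set Ω} {d : ℕ} (hB : NotShatters B (d + 1)) {n : ℕ}
    {x : Fin n → Ω} {S : Finset (Fin n)}
    (hS : ∀ T ⊆ S, ∃ f, S ∩ sampleTrace x (B f) = T) : S.card ≤ d := by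
  by_contra! hlt
  obtain ⟨S', hS', hcard⟩ := Finset.exists_subset_card_eq (Nat.succ_le_of_lt hlt)
  set e := S'.orderEmbOfFin hcard
  obtain ⟨T, hT⟩ := hB (x ∘ e)
  have he : ∀ j, e j ∈ S := fun j => hS' (Finset.orderEmbOfFin_mem _ _ _)
  obtain ⟨f, hf⟩ := hS (T.map e.toEmbedding) (by
    intro a ha
    obtain ⟨j, -, rfl⟩ := Finset.mem_map.1 ha
    exact he j)
  refine hT f ?_
  ext j
  have h1 : e j ∈ S ∩ sampleTrace x (B f) ↔ j ∈ T := by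
    rw [hf]
    exact Finset.mem_map' e.toEmbedding
  rw [← h1, Finset.mem_inter, mem_sampleTrace, mem_sampleTrace]
  exact ⟨fun h => ⟨he j, h⟩, fun h => h.2⟩

open Classical in
/-- The weight of the symmetric difference of two sets. -/
noncomputable def symmDiffWeight [Fintype Ω] (w : Ω → ℝ) (S T : Set Ω) : ℝ :=
  ∑ ω, if (ω ∈ S ↔ ω ∈ T) then 0 else w ω

-- Double counting of ordered pairs in `P`: a point `ω` splitting `P` into parts of sizes `a` and
-- `b` separates `2ab ≤ 2 |P| min(a, b)` of them, while each pair of distinct members is separated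
-- by weight at least `δ`.
open Classical in
theorem sum_min_card_ge [Fintype Ω] (B : ι → Set Ω) (w : Ω → ℝ) (hw : ∀ ω, 0 ≤ w ω) {δ : ℝ}
    (hsep : ∀ f g, f ≠ g → δ ≤ symmDiffWeight w (B f) (B g)) (P : Finset ι) (hP : P.Nonempty) :
    δ / 2 * (P.card - 1) ≤ ∑ ω, w ω *
      (min (P.filter fun f => ω ∉ B f).card (P.filter fun f => ω ∈ B f).card : ℕ) := by
  have hp : (0 : ℝ) < P.card := by exact_mod_cast hP.card_pos
  have h1 : ∀ ω, ∑ f ∈ P, ∑ g ∈ P, (if (ω ∈ B f ↔ ω ∈ B g) then (0 : ℝ) else 1) ≤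
      2 * P.card *
        (min (P.filter fun f => ω ∉ B f).card (P.filter fun f => ω ∈ B f).card : ℕ) := by
    intro ω
    set a := (P.filter fun f => ω ∈ B f).card with ha
    set b := (P.filter fun f => ω ∉ B f).card with hb
    have hab : a + b = P.card := Finset.card_filter_add_card_filter_not _
    have h2 : ∀ f ∈ P, ∑ g ∈ P, (if (ω ∈ B f ↔ ω ∈ B g) then (0 : ℝ) else 1) =
        if ω ∈ B f then (b : ℝ) else a := by
      intro f _
      split_ifs with h
      · simp only [h, true_iff, hb, Finset.card_filter, Nat.cast_sum]
        exact Finset.sum_congr rfl fun g _ => by split_ifs <;> simp_all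
      · simp only [h, false_iff, ha, Finset.card_filter, Nat.cast_sum]
        exact Finset.sum_congr rfl fun g _ => by split_ifs <;> simp_all
    rw [Finset.sum_congr rfl h2, Finset.sum_ite, Finset.sum_const, Finset.sum_const, ← ha, ← hb,
      nsmul_eq_mul, nsmul_eq_mul]
    have h3 : a * b + b * a ≤ 2 * P.card * min b a := by
      rw [← hab]
      rcases le_total a b with h | h
      · rw [min_eq_right h]; nlinarith
      · rw [min_eq_left h]; nlinarith
    exact_mod_cast h3
  have h2 : (P.card : ℝ) * (P.card - 1) * δ ≤ ∑ f ∈ P, ∑ g ∈ P, symmDiffWeight w (B f) (B g) := by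
    have : ∀ f ∈ P, (P.card - 1 : ℝ) * δ ≤ ∑ g ∈ P, symmDiffWeight w (B f) (B g) := by
      intro f hf
      have h3 : ∑ g ∈ P.erase f, δ ≤ ∑ g ∈ P.erase f, symmDiffWeight w (B f) (B g) :=
        Finset.sum_le_sum fun g hg => hsep f g (Finset.ne_of_mem_erase hg).symm
      rw [Finset.sum_const, Finset.card_erase_of_mem hf, nsmul_eq_mul,
        Nat.cast_sub hP.card_pos, Nat.cast_one] at h3
      refine h3.trans (Finset.sum_le_sum_of_subset_of_nonneg (Finset.erase_subset _ _)
        fun g _ _ => Finset.sum_nonneg fun ω _ => ?_)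
      split_ifs
      exacts [le_rfl, hw ω]
    have := Finset.sum_le_sum this
    rw [Finset.sum_const, nsmul_eq_mul] at this
    linarith
  have h3 : ∑ f ∈ P, ∑ g ∈ P, symmDiffWeight w (B f) (B g) =
      ∑ ω, w ω * ∑ f ∈ P, ∑ g ∈ P, (if (ω ∈ B f ↔ ω ∈ B g) then (0 : ℝ) else 1) := by
    simp only [symmDiffWeight, Finset.mul_sum, mul_ite, mul_zero, mul_one]
    rw [Finset.sum_comm (s := Finset.univ)]
    refine Finset.sum_congr rfl fun f _ => ?_
    rw [Finset.sum_comm]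
  have h4 : (P.card : ℝ) * (P.card - 1) * δ ≤ 2 * P.card * ∑ ω, w ω *
      (min (P.filter fun f => ω ∉ B f).card (P.filter fun f => ω ∈ B f).card : ℕ) := by
    refine (h2.trans_eq h3).trans ?_
    rw [Finset.mul_sum]
    refine Finset.sum_le_sum fun ω _ => ?_
    have := mul_le_mul_of_nonneg_left (h1 ω) (hw ω)
    linarith
  refine le_of_mul_le_mul_left ?_ (by positivity : (0 : ℝ) < 2 * P.card)
  linarith

/-- The trace of a sample, after inserting a point, splits into a fixed part and the new point. -/
theorem sampleTrace_insertNth {n : ℕ} (i : Fin (n + 1)) (ω : Ω) (y : Fin n → Ω) (S : Set Ω)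
    [Decidable (ω ∈ S)] :
    sampleTrace (i.insertNth ω y : Fin (n + 1) → Ω) S =
      if ω ∈ S then insert i ((sampleTrace y S).map i.succAboveEmb)
      else (sampleTrace y S).map i.succAboveEmb := by
  ext j
  rw [mem_sampleTrace]
  refine Fin.succAboveCases i ?_ (fun k => ?_) j
  · split_ifs with h <;> simp [h, Fin.succAbove_ne]
  · have : i.succAbove k ∈ (sampleTrace y S).map i.succAboveEmb ↔ y k ∈ S := by
      rw [← mem_sampleTrace]
      exact Finset.mem_map' i.succAboveEmb
    split_ifs with h <;> simp [this, Fin.succAbove_ne]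

variable [Fintype ι]

/-- The number of members of the family `B` whose trace on the sample `x` is `A`. -/
noncomputable def traceMult (B : ι → Set Ω) {n : ℕ} (x : Fin n → Ω) (A : Finset (Fin n)) : ℕ :=
  (Finset.univ.filter fun f => sampleTrace x (B f) = A).card

/-- The total weight of the edges in direction `i` of the one-inclusion graph of the traces on
`x`. -/
noncomputable def edgeWeight (B : ι → Set Ω) {n : ℕ} (i : Fin n) (x : Fin n → Ω) : ℕ :=
  ∑ A ∈ (Finset.univ.erase i).powerset, min (traceMult B x A) (traceMult B x (insert i A))

theorem sum_edgeWeight_le {B : ι → Set Ω} {d : ℕ} (hB : NotShatters B (d + 1)) {n : ℕ}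
    (x : Fin n → Ω) : ∑ i, edgeWeight B i x ≤ d * Fintype.card ι := by
  refine (sum_edges_min_le Finset.univ d (traceMult B x) fun S _ hS =>
    hB.card_le (x := x) fun T hT => ?_).trans_eq ?_
  · obtain ⟨A, -, hA, rfl⟩ := hS T hT
    obtain ⟨f, hf⟩ := Finset.card_ne_zero.1 hA
    exact ⟨f, by rw [(Finset.mem_filter.1 hf).2]⟩
  · rw [← Finset.card_univ, Finset.card_eq_sum_card_fiberwise
      (f := fun f => sampleTrace x (B f)) (t := Finset.univ.powerset) (by simp)]
    rfl

/-- The Sauer–Shelah lemma, applied to the traces as subsets of `Fin n`. -/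
theorem card_image_sampleTrace_le {B : ι → Set Ω} {d : ℕ} (hB : NotShatters B (d + 1)) {n : ℕ}
    (x : Fin n → Ω) :
    (Finset.univ.image fun f => sampleTrace x (B f)).card ≤ ∑ k ∈ Finset.Iic d, n.choose k := by
  refine (Finset.card_le_card_shatterer _).trans (Finset.card_shatterer_le_sum_vcDim.trans ?_)
  rw [Fintype.card_fin]
  refine Finset.sum_le_sum_of_subset (Finset.Iic_subset_Iic.2 (Finset.sup_le fun S hS => ?_))
  refine hB.card_le (x := x) fun T hT => ?_
  obtain ⟨A, hA, rfl⟩ := Finset.mem_shatterer.1 hS hT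
  obtain ⟨f, -, rfl⟩ := Finset.mem_image.1 hA
  exact ⟨f, rfl⟩

variable [Fintype Ω]

open Classical in
/-- Conditionally on the other points of a sample, the expected edge weight in one direction is at
least `δ / 2` times the difference of the numbers of sets and of traces. -/
theorem sum_edgeWeight_insertNth_ge (B : ι → Set Ω) (w : Ω → ℝ) (hw : ∀ ω, 0 ≤ w ω) {δ : ℝ}
    (hδ : 0 ≤ δ) (hsep : ∀ f g, f ≠ g → δ ≤ symmDiffWeight w (B f) (B g)) {n : ℕ}
    (i : Fin (n + 1)) (y : Fin n → Ω) :
    δ / 2 * (Fintype.card ι - (Finset.univ.image fun f => sampleTrace y (B f)).card) ≤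
      ∑ ω, w ω * (edgeWeight B i (i.insertNth ω y : Fin (n + 1) → Ω) : ℝ) := by
  set c : ι → Finset (Fin (n + 1)) := fun f => (sampleTrace y (B f)).map i.succAboveEmb with hc
  have hic : ∀ f, i ∉ c f := fun f => by simp [hc, Fin.succAbove_ne]
  set 𝒜 := Finset.univ.image c with h𝒜
  have hcard : 𝒜.card ≤ (Finset.univ.image fun f => sampleTrace y (B f)).card := by
    have : 𝒜 = (Finset.univ.image fun f => sampleTrace y (B f)).image
        (fun A => A.map i.succAboveEmb) := by
      rw [Finset.image_image]; rfl
    rw [this]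
    exact Finset.card_image_le
  have hsub : 𝒜 ⊆ (Finset.univ.erase i).powerset := by
    intro A hA
    obtain ⟨f, -, rfl⟩ := Finset.mem_image.1 hA
    exact Finset.mem_powerset.2 fun j hj =>
      Finset.mem_erase.2 ⟨fun h => hic f (h ▸ hj), Finset.mem_univ _⟩
  -- `P A` collects the members with trace `A` on the known points. The new point splits it into the
  -- two ends of the edge from `A` to `insert i A`.
  set P : Finset (Fin (n + 1)) → Finset ι := fun A => Finset.univ.filter fun f => c f = A with hP
  have hmult : ∀ ω, ∀ A ∈ 𝒜,
      traceMult B (i.insertNth ω y : Fin (n + 1) → Ω) A =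
        ((P A).filter fun f => ω ∉ B f).card ∧
      traceMult B (i.insertNth ω y : Fin (n + 1) → Ω) (insert i A) =
        ((P A).filter fun f => ω ∈ B f).card := by
    intro ω A hA
    have hiA : i ∉ A := fun h => by simpa using Finset.mem_powerset.1 (hsub hA) h
    refine ⟨?_, ?_⟩ <;> rw [traceMult, hP, Finset.filter_filter] <;>
      refine congrArg Finset.card (Finset.filter_congr fun f _ => ?_) <;>
      rw [sampleTrace_insertNth] <;> change (if _ then insert i (c f) else c f) = _ ↔ _
    · split_ifs with h
      · simp only [h, not_true_eq_false, and_false, iff_false]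
        exact fun h => hiA (h ▸ Finset.mem_insert_self _ _)
      · simp [h]
    · split_ifs with h
      · simp only [h, and_true]
        exact ⟨fun h => by
          rw [← Finset.erase_insert (hic f), h, Finset.erase_insert hiA], fun h => by rw [h]⟩
      · simp only [h, and_false, iff_false]
        exact fun h => hic f (h ▸ Finset.mem_insert_self _ _)
  have h1 : ∀ A ∈ 𝒜, δ / 2 * ((P A).card - 1) ≤ ∑ ω, w ω *
      (min (traceMult B (i.insertNth ω y : Fin (n + 1) → Ω) A)
        (traceMult B (i.insertNth ω y : Fin (n + 1) → Ω) (insert i A)) : ℕ) := by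
    intro A hA
    obtain ⟨f, -, hf⟩ := Finset.mem_image.1 hA
    refine (sum_min_card_ge B w hw hsep (P A) ⟨f, by simp [hP, hf]⟩).trans_eq ?_
    refine Finset.sum_congr rfl fun ω _ => ?_
    rw [(hmult ω A hA).1, (hmult ω A hA).2]
  have h2 : (Fintype.card ι : ℝ) = ∑ A ∈ 𝒜, ((P A).card : ℝ) := by
    rw [← Finset.card_univ, Finset.card_eq_sum_card_fiberwise (f := c) (t := 𝒜)
      (fun f _ => Finset.mem_image_of_mem _ (Finset.mem_univ _)), Nat.cast_sum]
  calc δ / 2 * (Fintype.card ι - (Finset.univ.image fun f => sampleTrace y (B f)).card : ℝ)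
      ≤ δ / 2 * (Fintype.card ι - 𝒜.card) := by
        have : (𝒜.card : ℝ) ≤ (Finset.univ.image fun f => sampleTrace y (B f)).card := by
          exact_mod_cast hcard
        gcongr
    _ = ∑ A ∈ 𝒜, δ / 2 * ((P A).card - 1) := by
        rw [← Finset.mul_sum, Finset.sum_sub_distrib, h2]; simp
    _ ≤ ∑ A ∈ 𝒜, ∑ ω, w ω *
      (min (traceMult B (i.insertNth ω y : Fin (n + 1) → Ω) A)
        (traceMult B (i.insertNth ω y : Fin (n + 1) → Ω) (insert i A)) : ℕ) :=
        Finset.sum_le_sum h1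
    _ ≤ _ := by
        rw [Finset.sum_comm]
        refine Finset.sum_le_sum fun ω _ => ?_
        rw [← Finset.mul_sum, ← Nat.cast_sum]
        refine mul_le_mul_of_nonneg_left ?_ (hw ω)
        exact_mod_cast Finset.sum_le_sum_of_subset hsub

/-- Integrating an i.i.d. sample of `n + 1` points by first integrating its `i`-th point. -/
theorem sum_prod_insertNth (w : Ω → ℝ) {n : ℕ} (i : Fin (n + 1)) (g : (Fin (n + 1) → Ω) → ℝ) :
    ∑ x : Fin (n + 1) → Ω, (∏ j, w (x j)) * g x =
      ∑ y : Fin n → Ω, (∏ j, w (y j)) * ∑ ω, w ω * g (i.insertNth ω y) := by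
  rw [← (Fin.insertNthEquiv (fun _ => Ω) i).sum_comp, Fintype.sum_prod_type, Finset.sum_comm]
  refine Finset.sum_congr rfl fun y _ => ?_
  rw [Finset.mul_sum]
  refine Finset.sum_congr rfl fun ω _ => ?_
  rw [Fin.prod_univ_succAbove _ i]
  simp only [Fin.insertNthEquiv_apply, Fin.insertNth_apply_same, Fin.insertNth_apply_succAbove]
  rw [mul_comm (w ω), mul_assoc]
  rfl

theorem sum_prod_eq_one (w : Ω → ℝ) (hw : ∑ ω, w ω = 1) (n : ℕ) :
    ∑ x : Fin n → Ω, ∏ j, w (x j) = 1 := by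
  classical
  rw [← Fintype.prod_sum]
  simp [hw]

/-- Two bounds on the expected total edge weight: each of the `n + 1` directions contributes at
least `K`, and every sample has total at most `d * card ι`. -/
theorem card_mul_le_of_separated {B : ι → Set Ω} {d : ℕ} (hB : NotShatters B (d + 1))
    (w : Ω → ℝ) (hw : ∀ ω, 0 ≤ w ω) (hw1 : ∑ ω, w ω = 1) {δ : ℝ} (hδ : 0 ≤ δ)
    (hsep : ∀ f g, f ≠ g → δ ≤ symmDiffWeight w (B f) (B g)) (n : ℕ) :
    (n + 1) * (δ / 2) * (Fintype.card ι - (∑ k ∈ Finset.Iic d, n.choose k : ℕ)) ≤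
      d * Fintype.card ι := by
  set K : ℝ := δ / 2 * (Fintype.card ι - (∑ k ∈ Finset.Iic d, n.choose k : ℕ)) with hK
  have h1 : ∀ i : Fin (n + 1),
      K ≤ ∑ x : Fin (n + 1) → Ω, (∏ j, w (x j)) * (edgeWeight B i x : ℝ) := by
    intro i
    rw [sum_prod_insertNth w i]
    calc K = ∑ y : Fin n → Ω, (∏ j, w (y j)) * K := by
          rw [← Finset.sum_mul, sum_prod_eq_one w hw1, one_mul]
      _ ≤ _ := by
          refine Finset.sum_le_sum fun y _ => mul_le_mul_of_nonneg_left ?_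
            (Finset.prod_nonneg fun j _ => hw _)
          refine le_trans ?_ (sum_edgeWeight_insertNth_ge B w hw hδ hsep i y)
          have : ((Finset.univ.image fun f => sampleTrace y (B f)).card : ℝ) ≤
              (∑ k ∈ Finset.Iic d, n.choose k : ℕ) := by
            exact_mod_cast card_image_sampleTrace_le hB y
          rw [hK]
          gcongr
  have h2 := Finset.sum_le_sum fun i (_ : i ∈ Finset.univ) => h1 i
  rw [Finset.sum_const, Finset.card_univ, Fintype.card_fin, nsmul_eq_mul, Finset.sum_comm] at h2
  have h3 : ∑ x : Fin (n + 1) → Ω, ∑ i, (∏ j, w (x j)) * (edgeWeight B i x : ℝ) ≤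
      ∑ x : Fin (n + 1) → Ω, (∏ j, w (x j)) * (d * Fintype.card ι : ℝ) := by
    refine Finset.sum_le_sum fun x _ => ?_
    rw [← Finset.mul_sum]
    refine mul_le_mul_of_nonneg_left ?_ (Finset.prod_nonneg fun j _ => hw _)
    exact_mod_cast sum_edgeWeight_le hB x
  rw [← Finset.sum_mul, sum_prod_eq_one w hw1, one_mul] at h3
  push_cast at h2
  calc _ = ((n : ℝ) + 1) * K := by rw [hK]; ring
    _ ≤ _ := h2.trans h3

/-- **Haussler's packing theorem**: a family of sets that shatters no `d + 1` points and whose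
members are `δ`-separated for a probability weight has at most `e (d + 1) (4 e / δ) ^ d` members. -/
theorem card_le_of_separated {B : ι → Set Ω} {d : ℕ} (hB : NotShatters B (d + 1))
    (w : Ω → ℝ) (hw : ∀ ω, 0 ≤ w ω) (hw1 : ∑ ω, w ω = 1) {δ : ℝ} (hδ : 0 < δ) (hδ1 : δ ≤ 1)
    (hsep : ∀ f g, f ≠ g → δ ≤ symmDiffWeight w (B f) (B g)) :
    (Fintype.card ι : ℝ) ≤ Real.exp 1 * (d + 1) * (4 * Real.exp 1 / δ) ^ d := by
  -- This makes `(n + 1) * (δ / 2)` at least `d + 1`, one more than the factor `d` on the right,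
  -- while `δ ≤ 1` keeps `n ≤ 4 (d + 1) / δ`.
  set n := ⌈2 * (d + 1) / δ⌉₊ with hn
  have hd0 : (0 : ℝ) ≤ d := d.cast_nonneg
  have hn1 : 2 * (d + 1) / δ ≤ (n : ℝ) := Nat.le_ceil _
  have hn2 : (n : ℝ) < 2 * (d + 1) / δ + 1 := Nat.ceil_lt_add_one (by positivity)
  have hge : 2 * ((d : ℝ) + 1) ≤ 2 * (d + 1) / δ := by
    rw [le_div_iff₀ hδ]
    nlinarith
  set S : ℝ := ((∑ k ∈ Finset.Iic d, n.choose k : ℕ) : ℝ) with hS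
  have hS0 : 0 ≤ S := Nat.cast_nonneg _
  have h1 := card_mul_le_of_separated hB w hw hw1 hδ.le hsep n
  rw [← hS] at h1
  have h2 : (d : ℝ) + 1 ≤ (n + 1) * (δ / 2) := by
    rw [div_le_iff₀ hδ] at hn1
    nlinarith
  have h3 : (Fintype.card ι : ℝ) ≤ (d + 1) * S := by
    by_contra! hlt
    have h4 : 0 ≤ (Fintype.card ι : ℝ) - S := by nlinarith
    nlinarith [mul_le_mul_of_nonneg_right h2 h4]
  have hSle : S ≤ Real.exp 1 * (4 * Real.exp 1 / δ) ^ d := by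
    rcases Nat.eq_zero_or_pos d with rfl | hd
    · have : S = 1 := by
        rw [hS]
        simp [show Finset.Iic 0 = ({0} : Finset ℕ) from rfl]
      rw [this, pow_zero, mul_one]
      exact Real.one_le_exp zero_le_one
    · have hd' : (0 : ℝ) < d := by exact_mod_cast hd
      have hdn : d ≤ n := by
        have : (d : ℝ) ≤ n := by linarith
        exact_mod_cast this
      refine (sum_choose_le_exp_mul_div_pow hd hdn).trans ?_
      have h5 : (n : ℝ) ≤ 4 * (d + 1) / δ := by
        have : 4 * ((d : ℝ) + 1) / δ = 2 * (d + 1) / δ + 2 * (d + 1) / δ := by ring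
        linarith
      have h6 : ((1 : ℝ) + 1 / d) ^ d ≤ Real.exp 1 := by
        calc ((1 : ℝ) + 1 / d) ^ d ≤ Real.exp (1 / d) ^ d := by
              gcongr; rw [add_comm]; exact Real.add_one_le_exp _
          _ = Real.exp 1 := by rw [← Real.exp_nat_mul]; congr 1; field_simp
      calc (Real.exp 1 * n / d) ^ d ≤ (Real.exp 1 * (4 * (d + 1) / δ) / d) ^ d := by gcongr
        _ = (1 + 1 / d) ^ d * (4 * Real.exp 1 / δ) ^ d := by
            rw [← mul_pow]; congr 1; field_simp
        _ ≤ _ := by gcongr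
  calc (Fintype.card ι : ℝ) ≤ (d + 1) * S := h3
    _ ≤ (d + 1) * (Real.exp 1 * (4 * Real.exp 1 / δ) ^ d) := by gcongr
    _ = _ := by ring

end Haussler

/-! ### The VC-index and maximal separated sets -/

theorem exists_not_sampleTrace {X : Type*} {𝓑 : Set (Set X)} {m : ℕ} {z : Fin m → X}
    (h : traceCard 𝓑 z < 2 ^ m) : ∃ T : Finset (Fin m), ∀ B ∈ 𝓑, sampleTrace z B ≠ T := by
  by_contra! hall
  choose φ hφ hT using hall
  refine h.not_ge ?_
  have hinj : Function.Injective fun T => φ T ∩ Set.range z := by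
    intro T T' hTT
    rw [← hT T, ← hT T']
    ext j
    have := congrArg (z j ∈ ·) hTT
    simpa [mem_sampleTrace] using this
  have hsub : Set.range (fun T => φ T ∩ Set.range z) ⊆
      {S : Set X | ∃ B ∈ 𝓑, S = B ∩ Set.range z} := by
    rintro _ ⟨T, rfl⟩
    exact ⟨φ T, hφ T, rfl⟩
  calc (2 : ℕ∞) ^ m = ENat.card (Finset (Fin m)) := by
        rw [ENat.card_eq_coe_fintype_card, Fintype.card_finset, Fintype.card_fin]; simp
    _ = (Set.range fun T => φ T ∩ Set.range z).encard := by
        rw [← Set.image_univ, hinj.encard_image, Set.encard_univ]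
    _ ≤ _ := Set.encard_le_encard hsub

theorem exists_vcIndex_eq {X : Type*} {𝓑 : Set (Set X)} (h : IsVCClass 𝓑) :
    ∃ n : ℕ, vcIndex 𝓑 = n ∧ ∀ z : Fin n → X, traceCard 𝓑 z < 2 ^ n := by
  have hne : Nonempty {n : ℕ // ∀ z : Fin n → X, traceCard 𝓑 z < 2 ^ n} := by
    by_contra hemp
    refine h ?_
    simp only [vcIndex, iInf_eq_top]
    exact fun n hn => (hemp ⟨n, hn⟩).elim
  have h1 := ciInf_mem fun n : {n : ℕ // ∀ z : Fin n → X, traceCard 𝓑 z < 2 ^ n} => (n.1 : ℕ∞)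
  obtain ⟨n, hn⟩ := h1
  refine ⟨n.1, ?_, n.2⟩
  rw [vcIndex, iInf_subtype']
  exact hn.symm

/-- The empty sample has one trace, which is `2 ^ 0`. Hence `V - 1` is a natural number. -/
theorem ne_zero_of_traceCard_lt {X : Type*} {𝓑 : Set (Set X)} (hne : 𝓑.Nonempty) {n : ℕ}
    (h : ∀ z : Fin n → X, traceCard 𝓑 z < 2 ^ n) : n ≠ 0 := by
  rintro rfl
  obtain ⟨T, hT⟩ := exists_not_sampleTrace (h Fin.elim0)
  obtain ⟨B, hB⟩ := hne
  exact hT B hB (Subsingleton.elim _ _)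

/-- If the finite separated subsets have bounded size, a maximal one is a net. -/
theorem exists_finset_net {α : Type*} (F : Set α) (R : α → α → Prop) (hrefl : ∀ f, R f f)
    (hsymm : ∀ f g, R f g → R g f) (N : ℕ)
    (hN : ∀ T : Finset α, (T : Set α) ⊆ F → (∀ f ∈ T, ∀ g ∈ T, f ≠ g → ¬ R f g) → T.card ≤ N) :
    ∃ T : Finset α, (T : Set α) ⊆ F ∧ (∀ f ∈ F, ∃ g ∈ T, R f g) ∧ T.card ≤ N := by
  classical
  set A : Set ℕ := {n | ∃ T : Finset α, (T : Set α) ⊆ F ∧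
    (∀ f ∈ T, ∀ g ∈ T, f ≠ g → ¬ R f g) ∧ T.card = n} with hA
  have hbdd : BddAbove A := ⟨N, by rintro _ ⟨T, h1, h2, rfl⟩; exact hN T h1 h2⟩
  have hne : A.Nonempty := ⟨0, ∅, by simp, by simp, rfl⟩
  obtain ⟨T, hTF, hsep, hcard⟩ := Nat.sSup_mem hne hbdd
  refine ⟨T, hTF, fun f hf => ?_, hN T hTF hsep⟩
  by_contra! hcov
  have hfT : f ∉ T := fun h => hcov f h (hrefl f)
  have : T.card + 1 ∈ A := by
    refine ⟨insert f T, by simpa [Set.insert_subset_iff] using ⟨hf, hTF⟩, ?_,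
      Finset.card_insert_of_notMem hfT⟩
    intro a ha b hb hab
    rcases Finset.mem_insert.1 ha with rfl | ha' <;> rcases Finset.mem_insert.1 hb with rfl | hb'
    · exact (hab rfl).elim
    · exact hcov b hb'
    · exact fun h => hcov a ha' (hsymm _ _ h)
    · exact hsep a ha' b hb' hab
  have := le_csSup hbdd this
  omega

/-! ### From `L²` distances to subgraphs -/

theorem eLpNorm_two_eq_sqrt_sum {E : Type*} [MeasurableSpace E] [MeasurableSingletonClass E]
    (Q : Measure E) [IsFiniteMeasure Q] {s : Finset E} (hs : Q (s : Set E)ᶜ = 0) (f : E → ℝ) :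
    eLpNorm f 2 Q = ENNReal.ofReal (√(∑ z ∈ s, Q.real {z} * f z ^ 2)) := by
  have hQ : Q.restrict (s : Set E) = Q := Measure.restrict_eq_self_of_ae_mem (by
    rw [ae_iff]; exact hs)
  rw [eLpNorm_eq_lintegral_rpow_enorm_toReal two_ne_zero ENNReal.ofNat_ne_top, ← hQ,
    lintegral_finset, hQ, Real.sqrt_eq_rpow,
    ← ENNReal.ofReal_rpow_of_nonneg (Finset.sum_nonneg fun z _ => by positivity) (by norm_num),
    ENNReal.ofReal_sum_of_nonneg fun z _ => by positivity]
  simp only [ENNReal.toReal_ofNat]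
  congr 1
  refine Finset.sum_congr rfl fun z _ => ?_
  rw [ENNReal.ofReal_mul measureReal_nonneg, ofReal_measureReal, mul_comm, ← sq_abs,
    ENNReal.ofReal_pow (abs_nonneg _), ← Real.enorm_eq_ofReal_abs]
  simp

/-- Fibrewise, two subgraphs differ exactly on the interval between the function values, which the
envelope keeps inside `[-c, c)`. -/
theorem volume_restrict_real_not_iff {a b c : ℝ} (ha : |a| ≤ c) (hb : |b| ≤ c) :
    (volume.restrict (Set.Ico (-c) c)).real {t : ℝ | ¬ (t < a ↔ t < b)} = |a - b| := by
  have hset : {t : ℝ | ¬ (t < a ↔ t < b)} = Set.Ico (min a b) (max a b) := by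
    ext t
    simp only [Set.mem_ofPred_eq, Set.mem_Ico, min_le_iff, lt_max_iff]
    constructor
    · intro h
      by_cases h1 : t < a <;> by_cases h2 : t < b <;> simp_all
    · rintro ⟨h1, h2⟩ h3
      rcases h1 with h1 | h1 <;> rcases h2 with h2 | h2
      · exact absurd h2 h1.not_gt
      · exact absurd (h3.2 h2) h1.not_gt
      · exact absurd (h3.1 h2) h1.not_gt
      · exact absurd h2 h1.not_gt
  have hsub : Set.Ico (min a b) (max a b) ⊆ Set.Ico (-c) c :=
    Set.Ico_subset_Ico (le_min (abs_le.1 ha).1 (abs_le.1 hb).1)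
      (max_le (abs_le.1 ha).2 (abs_le.1 hb).2)
  rw [hset, measureReal_restrict_apply measurableSet_Ico, Set.inter_eq_left.2 hsub,
    Real.volume_real_Ico_of_le min_le_max, max_sub_min_eq_abs, abs_sub_comm]

/-- A finite set of functions, dominated by `C`, whose subgraphs shatter no `d + 1` points and which
is separated in the weighted `ℓ²` distance has at most `e (d + 1) (16 e / ε²) ^ d` elements. -/
theorem card_le_of_l2_separated {E : Type*} {F : Set (E → ℝ)} {d : ℕ}
    (hF : ∀ z : Fin (d + 1) → E × ℝ, traceCard (subgraphs F) z < 2 ^ (d + 1))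
    {C : E → ℝ} (hC : ∀ h ∈ F, ∀ z, |h z| ≤ C z) (s : Finset E) (q : E → ℝ)
    (hq : ∀ z, 0 ≤ q z) (hD : 0 < ∑ z ∈ s, q z * C z ^ 2) {ε : ℝ} (hε : 0 < ε) (hε1 : ε < 1)
    (T : Finset (E → ℝ)) (hT : (T : Set (E → ℝ)) ⊆ F)
    (hsep : ∀ f ∈ T, ∀ g ∈ T, f ≠ g →
      ε ^ 2 * ∑ z ∈ s, q z * C z ^ 2 < ∑ z ∈ s, q z * (f z - g z) ^ 2) :
    (T.card : ℝ) ≤ Real.exp 1 * (d + 1) * (16 * Real.exp 1 / ε ^ 2) ^ d := by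
  classical
  rcases T.eq_empty_or_nonempty with rfl | ⟨f₀, hf₀⟩
  · rw [Finset.card_empty, Nat.cast_zero]; positivity
  have hC0 : ∀ z, 0 ≤ C z := fun z => (abs_nonneg _).trans (hC f₀ (hT hf₀) z)
  set D := ∑ z ∈ s, q z * C z ^ 2 with hDdef
  -- The packing bound needs a finite ground set, so points of `E × ℝ` lying in the same subgraphs
  -- of members of `T` are identified.
  let π : E × ℝ → Set T := fun p => {f | p.2 < f.1 p.1}
  let Ω := Set.range π
  have : Fintype Ω := Fintype.ofFinite _
  let B : T → Set Ω := fun f => {a | f ∈ a.1}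
  have hB : NotShatters B (d + 1) := by
    intro z
    choose p hp using fun j => (z j).2
    obtain ⟨A, hA⟩ := exists_not_sampleTrace (hF p)
    refine ⟨A, fun f => ?_⟩
    convert hA _ ⟨f.1, hT f.2, rfl⟩ using 1
    ext j
    rw [mem_sampleTrace, mem_sampleTrace]
    change f ∈ (z j).1 ↔ _
    rw [← hp]
    rfl
  let r : E → ℝ → Ω := fun z t => ⟨π (z, t), Set.mem_range_self _⟩
  let μ : E → Measure ℝ := fun z => volume.restrict (Set.Ico (-C z) (C z))
  have hfin : ∀ z, IsFiniteMeasure (μ z) := fun z => inferInstance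
  have hmeas : ∀ z (a : Ω), MeasurableSet (r z ⁻¹' {a}) := by
    intro z a
    have : r z ⁻¹' {a} = ⋂ f : T, {t : ℝ | t < f.1 z ↔ f ∈ a.1} := by
      ext t
      simp only [Set.mem_preimage, Set.mem_singleton_iff, Set.mem_iInter, Set.mem_ofPred_eq,
        Subtype.ext_iff, Set.ext_iff]
      rfl
    rw [this]
    refine MeasurableSet.iInter fun f => ?_
    by_cases h : f ∈ a.1
    · simp only [h, iff_true]
      exact measurableSet_Iio
    · simp only [h, iff_false, not_lt]
      exact measurableSet_Ici
  -- The fibre over `z` has length `2 C z`, so the total mass before normalisation is `∑ q C * 2C =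
  -- 2D`.
  let w : Ω → ℝ := fun a => (∑ z ∈ s, q z * C z * (μ z).real (r z ⁻¹' {a})) / (2 * D)
  have hsum : ∀ A : Finset Ω, ∑ a ∈ A, w a =
      (∑ z ∈ s, q z * C z * (μ z).real (r z ⁻¹' A)) / (2 * D) := by
    intro A
    rw [← Finset.sum_div, Finset.sum_comm]
    congr 1
    refine Finset.sum_congr rfl fun z _ => ?_
    rw [← Finset.mul_sum, sum_measureReal_preimage_singleton A fun a _ => hmeas z a]
  have hw : ∀ a, 0 ≤ w a := fun a => div_nonneg
    (Finset.sum_nonneg fun z _ => mul_nonneg (mul_nonneg (hq z) (hC0 z)) measureReal_nonneg)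
    (by positivity)
  have hw1 : ∑ a, w a = 1 := by
    rw [hsum, div_eq_one_iff_eq (by positivity), hDdef, Finset.mul_sum]
    refine Finset.sum_congr rfl fun z _ => ?_
    rw [Finset.coe_univ, Set.preimage_univ, measureReal_restrict_apply_univ,
      Real.volume_real_Ico_of_le (by linarith [hC0 z])]
    ring
  have hdist : ∀ f g : T, symmDiffWeight w (B f) (B g) =
      (∑ z ∈ s, q z * C z * |f.1 z - g.1 z|) / (2 * D) := by
    intro f g
    have h1 : symmDiffWeight w (B f) (B g) =
        ∑ a ∈ Finset.univ.filter (fun a => ¬ (a ∈ B f ↔ a ∈ B g)), w a := by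
      rw [symmDiffWeight, Finset.sum_filter]
      exact Finset.sum_congr rfl fun a _ => by split_ifs <;> simp_all
    rw [h1, hsum]
    congr 1
    refine Finset.sum_congr rfl fun z _ => ?_
    congr 1
    rw [← volume_restrict_real_not_iff (hC f (hT f.2) z) (hC g (hT g.2) z)]
    congr 1
    ext t
    simp only [Set.mem_preimage, Finset.coe_filter, Finset.mem_univ, true_and, Set.mem_ofPred_eq]
    rfl
  -- One factor 2 comes from `(f - g)² ≤ 2C |f - g|`, the other from the normalisation by `2D`.
  have hδ : ∀ f g : T, f ≠ g → ε ^ 2 / 4 ≤ symmDiffWeight w (B f) (B g) := by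
    intro f g hfg
    rw [hdist, le_div_iff₀ (by positivity)]
    have h1 := hsep f f.2 g g.2 fun h => hfg (Subtype.ext h)
    have h2 : ∑ z ∈ s, q z * (f.1 z - g.1 z) ^ 2 ≤
        2 * ∑ z ∈ s, q z * C z * |f.1 z - g.1 z| := by
      rw [Finset.mul_sum]
      refine Finset.sum_le_sum fun z _ => ?_
      have h3 : |f.1 z - g.1 z| ≤ 2 * C z := by
        have := abs_sub (f.1 z) (g.1 z)
        linarith [hC f (hT f.2) z, hC g (hT g.2) z]
      rw [← sq_abs]
      nlinarith [mul_le_mul_of_nonneg_right h3 (abs_nonneg (f.1 z - g.1 z)), hq z,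
        mul_le_mul_of_nonneg_left
          (mul_le_mul_of_nonneg_right h3 (abs_nonneg (f.1 z - g.1 z))) (hq z)]
    linarith
  have := card_le_of_separated hB w hw hw1 (by positivity) (by nlinarith) hδ
  rw [Fintype.card_coe] at this
  refine this.trans_eq ?_
  congr 2
  field_simp
  ring

/-- Uniform covering numbers of a VC-subgraph class over finitely supported probability measures. -/
theorem iSup_lpCoveringNumber_le {E : Type*} [MeasurableSpace E] [MeasurableSingletonClass E]
    {F : Set (E → ℝ)} (hne : F.Nonempty) (hF : IsVCSubgraphClass F) {C : E → ℝ}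
    (hC : IsPositiveEnvelope F C) {ε : ℝ} (hε : 0 < ε) (hε1 : ε < 1) :
    ⨆ Q ∈ finSuppProb E,
        ((lpCoveringNumber (ENNReal.ofReal ε * eLpNorm C 2 Q) F 2 Q : ℕ∞) : ℝ≥0∞) ≤
      ENNReal.ofReal (Real.exp 1 * ((vcSubgraphIndex F).toNat : ℝ) *
        (4 * Real.exp (1 / 2) / ε) ^ (2 * (((vcSubgraphIndex F).toNat : ℝ) - 1))) := by
  obtain ⟨n, hn, htr⟩ := exists_vcIndex_eq hF.2
  have hn0 : n ≠ 0 := ne_zero_of_traceCard_lt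
    (𝓑 := subgraphs F) (hne.elim fun h hh => ⟨_, h, hh, rfl⟩) htr
  obtain ⟨v, rfl⟩ := Nat.exists_eq_succ_of_ne_zero hn0
  have hV : (vcSubgraphIndex F).toNat = v + 1 := by
    rw [vcSubgraphIndex, hn]; rfl
  set K : ℝ := Real.exp 1 * (v + 1) * (16 * Real.exp 1 / ε ^ 2) ^ v with hK
  have hK0 : 0 ≤ K := by positivity
  have hRHS : Real.exp 1 * ((vcSubgraphIndex F).toNat : ℝ) * (4 * Real.exp (1 / 2) / ε) ^
      (2 * (((vcSubgraphIndex F).toNat : ℝ) - 1)) = K := by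
    rw [hV, hK, Nat.cast_add, Nat.cast_one, add_sub_cancel_right,
      Real.rpow_mul (by positivity), Real.rpow_natCast, Real.rpow_ofNat, div_pow, mul_pow,
      ← Real.exp_nat_mul]
    norm_num
  rw [hRHS]
  refine iSup₂_le fun Q hQ => ?_
  obtain ⟨hprob, s, hs⟩ := hQ
  have hnorm := eLpNorm_two_eq_sqrt_sum Q hs
  -- Strict positivity of `C` enters here: a zero sum would force `Q` to vanish on `s`, which
  -- carries all its mass.
  have hD : 0 < ∑ z ∈ s, Q.real {z} * C z ^ 2 := by
    refine (Finset.sum_nonneg fun z _ => by positivity).lt_of_ne fun h0 => ?_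
    rw [eq_comm, Finset.sum_eq_zero_iff_of_nonneg fun z _ => by positivity] at h0
    have h1 : ∑ z ∈ s, Q.real {z} = 0 := Finset.sum_eq_zero fun z hz =>
      (mul_eq_zero.1 (h0 z hz)).resolve_right (pow_pos (hC.2.2 z) 2).ne'
    rw [sum_measureReal_singleton] at h1
    have h2 := probReal_compl_eq_one_sub (μ := Q) s.measurableSet
    rw [h1, measureReal_def, hs] at h2
    simp at h2
  obtain ⟨T, hTF, hcov, hcard⟩ := exists_finset_net F
    (fun f g => eLpNorm (f - g) 2 Q ≤ ENNReal.ofReal ε * eLpNorm C 2 Q)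
    (fun f => by simp) (fun f g h => by rwa [eLpNorm_sub_comm]) ⌊K⌋₊ fun T hT hsep => by
      refine Nat.le_floor (card_le_of_l2_separated htr hC.2.1 s (fun z => Q.real {z})
        (fun z => measureReal_nonneg) hD hε hε1 T hT fun f hf g hg hfg => ?_)
      have h1 := hsep f hf g hg hfg
      rw [hnorm, hnorm, ← ENNReal.ofReal_mul hε.le,
        ENNReal.ofReal_le_ofReal_iff (by positivity), not_le, Real.lt_sqrt (by positivity),
        mul_pow, Real.sq_sqrt hD.le] at h1
      exact h1
  have h1 : lpCoveringNumber (ENNReal.ofReal ε * eLpNorm C 2 Q) F 2 Q ≤ (T.card : ℕ∞) := by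
    rw [← Set.encard_coe_eq_coe_finsetCard]
    exact iInf_le_of_le (T : Set _) (iInf_le_of_le hTF (iInf_le_of_le hcov le_rfl))
  calc ((lpCoveringNumber (ENNReal.ofReal ε * eLpNorm C 2 Q) F 2 Q : ℕ∞) : ℝ≥0∞)
      ≤ ((T.card : ℕ∞) : ℝ≥0∞) := ENat.toENNReal_le.2 h1
    _ = ENNReal.ofReal (T.card : ℝ) := by simp
    _ ≤ ENNReal.ofReal K := ENNReal.ofReal_le_ofReal
        ((Nat.cast_le.2 hcard).trans (Nat.floor_le hK0))

end EmpiricalProcess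

theorem mainTheorem11 (d : ℕ) (F : Set (EuclideanSpace ℝ (Fin d) → ℝ)) (hne : F.Nonempty)
    (hF : EmpiricalProcess.IsVCSubgraphClass F) (C : EuclideanSpace ℝ (Fin d) → ℝ)
    (hC : EmpiricalProcess.IsPositiveEnvelope F C) (ε : ℝ) (hε : 0 < ε) (hε1 : ε < 1) :
    ⨆ Q ∈ EmpiricalProcess.finSuppProb (EuclideanSpace ℝ (Fin d)),
        ((EmpiricalProcess.lpCoveringNumber (ENNReal.ofReal ε * eLpNorm C 2 Q) F 2 Q : ℕ∞) : ℝ≥0∞) ≤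
      ENNReal.ofReal (Real.exp 1 * ((EmpiricalProcess.vcSubgraphIndex F).toNat : ℝ) *
        (4 * Real.exp (1 / 2) / ε) ^
          (2 * (((EmpiricalProcess.vcSubgraphIndex F).toNat : ℝ) - 1))) := by
  exact EmpiricalProcess.iSup_lpCoveringNumber_le hne hF hC hε hε1
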